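/- **Definitions.** In a partially ordered set, $x$ is *way-below* $y$, written $x\ll y$, if for every increasing sequence $(y_n)_n$ that has a supremum with $y\leq\sup_n y_n$ there is $n$ with $x\leq y_n$. A *$\mathrm{Cu}$-semigroup* is a commutative, positively ordered monoid $S$ (the order is a partial order compatible with addition, and $0\leq x$ for all $x$) such that: (O1) every increasing sequence has a supremum; (O2) every element is the supremum of a $\ll$-increasing sequence; (O3) $x'\ll x$ and $y'\ll y$ imply $x'+y'\ll x+y$; (O4) $\sup_n x_n+\sup_n y_n=\sup_n(x_n+y_n)$ for all increasing sequences $(x_n)_n$, $(y_n)_n$. Consider further the properties: * (O5) if $x+y\leq z$, $x'\ll x$ and $y'\ll y$, then there is $c$ with $x'+c\leq z\leq x+c$ and $y'\ll c$; * (O6) if $x'\ll x\leq y+z$, then there are $v\leq x,y$ and $w\leq x,z$ with $x'\leq v+w$. $S$ is *weakly cancellative* if $x+z\ll y+z$ implies $x\ll y$. A subset $D\subseteq S$ is *sup-dense* if whenever $x'\ll x$ in $S$ there is $y\in D$ with $x'\leq y\ll x$; $S$ is *countably based* if it has a countable sup-dense subset. An *ideal* is a downward-hereditary submonoid closed under suprema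 of increasing sequences, and $S$ is *simple* if its only ideals are $\{0\}$ and $S$. An element $x$ is *compact* if $x\ll x$, and $S$ is *algebraic* if its compact elements are sup-dense. An element $x$ is *soft* if $x=0$, or if $x\neq 0$ and for every $x'\ll x$ there is a nonzero $t\in S$ with $x'+t\ll x$; $S$ is *soft* if all of its elements are soft. The soft elements of $S$ form a submonoid $S_{\mathrm{soft}}$, ordered as a subset of $S$. An element $x$ has *thin boundary* if $x\ll x+t$ for every nonzero $t\in S$. For $n\in\mathbb{N}=\{0,1,2,\ldots\}$, we write $\dim(S)\leq n$ if whenever $x'\ll x\ll y_1+\ldots+y_r$ in $S$ there are $z_{j,k}\in S$ ($1\leq j\leq r$, $0\leq k\leq n$) such that $z_{j,k}\ll y_j$ for all $j,k$, $x'\ll\sum_{j,k}z_{j,k}$, and $\sum_{j}z_{j,k}\ll x$ for each $k$; the *dimension* $\dim(S)\in\{0,1,\ldots,\infty\}$ is the smallest such $n$, or $\infty$ if there is none. **Theorem.** Let $S$ be a countably based, simple, soft, weakly cancellative $\mathrm{Cu}$-semigroup satisfying (O5) and (O6). Then the following conditions are equivalent: 1. $\dim(S)=0$; 2. the elements of $S$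 with thin boundary are sup-dense in $S$; 3. there exists a countably based, simple, algebraic, weakly cancellative $\mathrm{Cu}$-semigroup $T$ satisfying (O5) and (O6) such that $S\cong T_{\mathrm{soft}}$ (isomorphism of ordered monoids, which is the same as isomorphism of $\mathrm{Cu}$-semigroups). -/

import Mathlib

namespace CuntzSemigroup

section Order

variable {S : Type*} [PartialOrder S]

/-- `x` is way-below `y` (sequential version, written `x ≪ y` in the comments): every increasing
sequence that has a supremum `s` with `y ≤ s` has a term that dominates `x`. -/
def WayBelow (x y : S) : Prop :=
  ∀ u : ℕ → S, Monotone u → ∀ s : S, IsLUB (Set.range u) s → y ≤ s → ∃ n, x ≤ u n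

/-- A subset `D` is sup-dense if `x' ≪ x` implies `x' ≤ y ≪ x` for some `y ∈ D`. -/
def IsSupDense (D : Set S) : Prop :=
  ∀ x' x : S, WayBelow x' x → ∃ y ∈ D, x' ≤ y ∧ WayBelow y x

/-- An element is compact if it is way-below itself. -/
def IsCompactElt (x : S) : Prop := WayBelow x x

theorem WayBelow.trans_le {x y z : S} (h : WayBelow x y) (hyz : y ≤ z) : WayBelow x z :=
  fun u hu s hs hz => h u hu s hs (hyz.trans hz)

theorem WayBelow.le_trans {x y z : S} (hxy : x ≤ y) (h : WayBelow y z) : WayBelow x z :=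
  fun u hu s hs hz => (h u hu s hs hz).imp fun _ hn => hxy.trans hn

end Order

/-- A `Cu`-semigroup: a commutative positively ordered monoid satisfying (O1)-(O4). -/
class IsCuSemigroup (S : Type*) [AddCommMonoid S] [PartialOrder S] : Prop
    extends IsOrderedAddMonoid S where
  /-- The order is positive. -/
  zero_le : ∀ x : S, 0 ≤ x
  /-- (O1): every increasing sequence has a supremum. -/
  exists_sup : ∀ u : ℕ → S, Monotone u → ∃ s, IsLUB (Set.range u) s
  /-- (O2): every element is the supremum of a `≪`-increasing sequence. -/
  exists_wayBelow_seq : ∀ x : S, ∃ u : ℕ → S,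
    (∀ n, WayBelow (u n) (u (n + 1))) ∧ IsLUB (Set.range u) x
  /-- (O3): addition preserves the way-below relation. -/
  wayBelow_add : ∀ x' x y' y : S, WayBelow x' x → WayBelow y' y → WayBelow (x' + y') (x + y)
  /-- (O4): addition preserves suprema of increasing sequences. -/
  sup_add : ∀ u v : ℕ → S, Monotone u → Monotone v → ∀ a b : S,
    IsLUB (Set.range u) a → IsLUB (Set.range v) b →
      IsLUB (Set.range fun n => u n + v n) (a + b)

section Properties

variable (S : Type*) [AddCommMonoid S] [PartialOrder S]

/-- Axiom (O5). -/
def O5 : Prop :=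
  ∀ x' x y' y z : S, x + y ≤ z → WayBelow x' x → WayBelow y' y →
    ∃ c : S, x' + c ≤ z ∧ z ≤ x + c ∧ WayBelow y' c

/-- Axiom (O6). -/
def O6 : Prop :=
  ∀ x' x y z : S, WayBelow x' x → x ≤ y + z →
    ∃ v w : S, v ≤ x ∧ v ≤ y ∧ w ≤ x ∧ w ≤ z ∧ x' ≤ v + w

/-- Weak cancellation: `x + z ≪ y + z` implies `x ≪ y`. -/
def WeaklyCancellative : Prop :=
  ∀ x y z : S, WayBelow (x + z) (y + z) → WayBelow x y

/-- There is a countable sup-dense subset. -/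
def CountablyBased : Prop :=
  ∃ D : Set S, D.Countable ∧ IsSupDense D

/-- The compact elements are sup-dense. -/
def Algebraic : Prop :=
  IsSupDense {x : S | IsCompactElt x}

variable {S} in
/-- An ideal is a downward-hereditary submonoid closed under suprema of increasing sequences. -/
def IsIdeal (I : AddSubmonoid S) : Prop :=
  (∀ x y : S, x ≤ y → y ∈ I → x ∈ I) ∧
    ∀ u : ℕ → S, Monotone u → (∀ n, u n ∈ I) → ∀ s : S, IsLUB (Set.range u) s → s ∈ I

/-- `S` is simple if `{0}` and `S` are its only ideals. -/
def Simple : Prop :=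
  ∀ I : AddSubmonoid S, IsIdeal I → I = ⊥ ∨ I = ⊤

/-- The condition `dim(S) ≤ n`: whenever `x' ≪ x ≪ y₁ + … + yᵣ`, there are `z j k`, for
`j = 1, …, r` and `k = 0, …, n`, with `z j k ≪ y j`, with `x' ≪ ∑ z j k`, and with
`∑ⱼ z j k ≪ x` for each `k`. -/
def DimLE (n : ℕ) : Prop :=
  ∀ (x' x : S) (r : ℕ) (y : Fin r → S), WayBelow x' x → WayBelow x (∑ j, y j) →
    ∃ z : Fin r → Fin (n + 1) → S,
      (∀ j k, WayBelow (z j k) (y j)) ∧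
      WayBelow x' (∑ j, ∑ k, z j k) ∧
      ∀ k, WayBelow (∑ j, z j k) x

/-- The covering dimension: the least `n` with `dim(S) ≤ n`, and `∞` if there is none. -/
noncomputable def dim : ℕ∞ :=
  sInf {d : ℕ∞ | ∃ n : ℕ, d = n ∧ DimLE S n}

variable {S}

/-- `x` has thin boundary if `x ≪ x + t` for every nonzero `t`. -/
def HasThinBoundary (x : S) : Prop :=
  ∀ t : S, t ≠ 0 → WayBelow x (x + t)

/-- `x` is soft if `x = 0`, or `x ≠ 0` and for every `x' ≪ x` there is a nonzero `t` with
`x' + t ≪ x`. -/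
def IsSoft (x : S) : Prop :=
  x = 0 ∨ (x ≠ 0 ∧ ∀ x' : S, WayBelow x' x → ∃ t : S, t ≠ 0 ∧ WayBelow (x' + t) x)

variable (S) in
/-- `S` is soft if all its elements are soft. -/
def Soft : Prop :=
  ∀ x : S, IsSoft x

end Properties

section SoftPart

variable {S : Type*} [AddCommMonoid S] [PartialOrder S] [IsCuSemigroup S]

theorem exists_le_add_of_wayBelow_add {z x y : S} (h : WayBelow z (x + y)) :
    ∃ x' y' : S, WayBelow x' x ∧ WayBelow y' y ∧ z ≤ x' + y' := by
  obtain ⟨u, hu, hux⟩ := IsCuSemigroup.exists_wayBelow_seq x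
  obtain ⟨v, hv, hvy⟩ := IsCuSemigroup.exists_wayBelow_seq y
  have le_of : ∀ {a b : S}, WayBelow a b → a ≤ b := fun {a b} hab => by
    obtain ⟨n, hn⟩ := hab (fun _ => b) monotone_const b (by simp) le_rfl
    exact hn
  have hum : Monotone u := monotone_nat_of_le_succ fun n => le_of (hu n)
  have hvm : Monotone v := monotone_nat_of_le_succ fun n => le_of (hv n)
  obtain ⟨n, hn⟩ := h (fun n => u n + v n) (fun i j hij => add_le_add (hum hij) (hvm hij)) _
    (IsCuSemigroup.sup_add u v hum hvm x y hux hvy) le_rfl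
  exact ⟨u n, v n, (hu n).trans_le (hux.1 ⟨n + 1, rfl⟩),
    (hv n).trans_le (hvy.1 ⟨n + 1, rfl⟩), hn⟩

theorem IsSoft.add {x y : S} (hx : IsSoft x) (hy : IsSoft y) : IsSoft (x + y) := by
  rcases hx with rfl | ⟨hx0, hx⟩
  · simpa using hy
  · refine Or.inr ⟨fun h => hx0 (le_antisymm ?_ (IsCuSemigroup.zero_le x)), fun z hz => ?_⟩
    · calc x = x + 0 := (add_zero x).symm
        _ ≤ x + y := add_le_add le_rfl (IsCuSemigroup.zero_le y)
        _ = 0 := h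
    · obtain ⟨x', y', hx', hy', hle⟩ := exists_le_add_of_wayBelow_add hz
      obtain ⟨t, ht0, ht⟩ := hx x' hx'
      refine ⟨t, ht0, WayBelow.le_trans ?_ (IsCuSemigroup.wayBelow_add _ _ _ _ ht hy')⟩
      calc z + t ≤ x' + y' + t := add_le_add hle le_rfl
        _ = x' + t + y' := add_right_comm _ _ _

variable (S) in
/-- The soft part of `S`: the submonoid of soft elements, with the order induced from `S`. -/
def softPart : AddSubmonoid S where
  carrier := {x | IsSoft x}
  zero_mem' := Or.inl rfl
  add_mem' := IsSoft.add

end SoftPart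

end CuntzSemigroup

universe u

open CuntzSemigroup

/-!
In a soft, weakly cancellative semigroup an element with thin boundary behaves like a compact
element that has been perturbed infinitesimally.

If `dim S = 0`, every interval `u ≪ v` can be shrunk to one whose end points differ by less than a
prescribed nonzero element. A nested sequence of such intervals, shrinking past every member of a
countable sup-dense set, closes down on an element with thin boundary.

Conversely, weak cancellation equips elements with thin boundary with complements and Riesz
decompositions, and decomposing such an element along `x ≪ y₁ + ⋯ + yᵣ` is what dimension zero asks
for. The same two properties pass to a countable sup-dense submonoid `C` of elements with thin
boundary, and `T` is obtained from `S` by adjoining a compact copy of each nonzero element of `C`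
just above the original.

Finally, let `S` be the soft part of an algebraic `T`. If every nonzero compact element of `T` is a
sum of two nonzero ones, each exceeds a soft element below it by less than any nonzero element, and
these soft elements have thin boundary in `S` and are sup-dense. Otherwise each nonzero soft element
is the largest element of `S`, and every element that is way below another one has thin boundary.
-/

namespace CuntzSemigroup

local infix:50 " ≪ " => WayBelow

theorem exists_seq_of_forall_exists {α : Type*} {p : α → Prop} {r : ℕ → α → α → Prop}
    (h : ∀ n a, p a → ∃ b, p b ∧ r n a b) {a : α} (ha : p a) :
    ∃ u : ℕ → α, u 0 = a ∧ (∀ n, p (u n)) ∧ ∀ n, r n (u n) (u (n + 1)) := by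
  have : Nonempty α := ⟨a⟩
  choose! f hp hr using h
  let u : ℕ → α := fun n => Nat.rec a f n
  have hu : ∀ n, p (u n) := Nat.rec ha fun n => hp n _
  exact ⟨u, rfl, hu, fun n => hr n _ (hu n)⟩

section Order

variable {S : Type*} [PartialOrder S] {x y z : S}

theorem WayBelow.le (h : x ≪ y) : x ≤ y := by
  obtain ⟨_, hn⟩ := h (fun _ => y) monotone_const y (by simp) le_rfl
  exact hn

theorem WayBelow.trans (hxy : x ≪ y) (hyz : y ≪ z) : x ≪ z :=
  hxy.trans_le hyz.le

instance : Trans (α := S) WayBelow WayBelow WayBelow := ⟨WayBelow.trans⟩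

instance : Trans (α := S) WayBelow (· ≤ ·) WayBelow := ⟨WayBelow.trans_le⟩

instance : Trans (α := S) (· ≤ ·) WayBelow WayBelow := ⟨WayBelow.le_trans⟩

theorem monotone_of_wayBelow_succ {u : ℕ → S} (hu : ∀ n, u n ≪ u (n + 1)) : Monotone u :=
  monotone_nat_of_le_succ fun n => (hu n).le

theorem wayBelow_of_isLUB {u : ℕ → S} (hu : ∀ n, u n ≪ u (n + 1)) (hx : IsLUB (Set.range u) x)
    (n : ℕ) : u n ≪ x :=
  (hu n).trans_le (hx.1 ⟨n + 1, rfl⟩)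

theorem WayBelow.map_orderIso {T : Type*} [PartialOrder T] (h : x ≪ y) (e : S ≃o T) :
    e x ≪ e y := by
  intro u hu s hs hys
  obtain ⟨n, hn⟩ := h (e.symm ∘ u) (e.symm.monotone.comp hu) (e.symm s)
    (by rw [Set.range_comp]; exact e.symm.isLUB_image'.2 hs) (e.le_symm_apply.2 hys)
  exact ⟨n, e.le_symm_apply.1 hn⟩

end Order

section Basic

variable {S : Type*} [AddCommMonoid S] [PartialOrder S]

theorem WeaklyCancellative.cancel_left (hc : WeaklyCancellative S) {x y z : S}
    (h : z + x ≪ z + y) : x ≪ y :=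
  hc x y z (by rwa [add_comm x, add_comm y])

variable [IsCuSemigroup S] {x y z : S}

instance : IsBotZeroClass S := ⟨IsCuSemigroup.zero_le⟩

theorem ne_zero_of_le (hx : x ≠ 0) (h : x ≤ y) : y ≠ 0 := (hx.pos.trans_le h).ne'

theorem add_eq_zero_iff_eq_zero : x + y = 0 ↔ x = 0 ∧ y = 0 :=
  add_eq_zero_iff_of_nonneg zero_le zero_le

theorem zero_wayBelow (x : S) : 0 ≪ x := fun _ _ _ _ _ => ⟨0, zero_le⟩

theorem WayBelow.add {x' y' : S} (hx : x' ≪ x) (hy : y' ≪ y) : x' + y' ≪ x + y :=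
  IsCuSemigroup.wayBelow_add _ _ _ _ hx hy

theorem WayBelow.sum {ι : Type*} (s : Finset ι) {f g : ι → S} (h : ∀ i ∈ s, f i ≪ g i) :
    ∑ i ∈ s, f i ≪ ∑ i ∈ s, g i := by
  simpa only [Prod.fst_sum, Prod.snd_sum] using
    Finset.sum_induction (fun i => (f i, g i)) (fun p : S × S => p.1 ≪ p.2)
      (fun _ _ => WayBelow.add) (zero_wayBelow 0) h

theorem WayBelow.nsmul (n : ℕ) (h : x ≪ y) : n • x ≪ n • y := by
  simpa using WayBelow.sum (Finset.range n) fun _ _ => h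

theorem WayBelow.exists_between (h : x ≪ z) : ∃ y, x ≪ y ∧ y ≪ z := by
  obtain ⟨u, hu, hz⟩ := IsCuSemigroup.exists_wayBelow_seq z
  obtain ⟨n, hn⟩ := h u (monotone_of_wayBelow_succ hu) z hz le_rfl
  exact ⟨u (n + 1), (hu n).le_trans hn, wayBelow_of_isLUB hu hz _⟩

theorem WayBelow.exists_wayBelow_term (h : x ≪ y) {u : ℕ → S} (hu : Monotone u)
    (hy : IsLUB (Set.range u) y) : ∃ n, x ≪ u n := by
  obtain ⟨z, hxz, hz⟩ := h.exists_between
  obtain ⟨n, hn⟩ := hz u hu y hy le_rfl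
  exact ⟨n, hxz.trans_le hn⟩

theorem le_of_forall_wayBelow (h : ∀ x', x' ≪ x → x' ≤ y) : x ≤ y := by
  obtain ⟨u, hu, hx⟩ := IsCuSemigroup.exists_wayBelow_seq x
  exact hx.2 (Set.forall_mem_range.2 fun n => h _ (wayBelow_of_isLUB hu hx n))

theorem exists_ne_zero_wayBelow (hx : x ≠ 0) : ∃ x', x' ≠ 0 ∧ x' ≪ x := by
  by_contra! h
  exact hx (le_of_forall_wayBelow fun x' hx' =>
    (not_imp_not.1 (h x') hx').le).eq_zero

theorem WayBelow.exists_wayBelow_add_left (h : z ≪ x + y) : ∃ x', x' ≪ x ∧ z ≪ x' + y := by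
  obtain ⟨w, hzw, hw⟩ := h.exists_between
  obtain ⟨x', y', hx', hy', hle⟩ := exists_le_add_of_wayBelow_add hw
  exact ⟨x', hx', hzw.trans_le (hle.trans (by gcongr; exact hy'.le))⟩

theorem isLUB_range_const_add (a : S) {u : ℕ → S} (hu : Monotone u)
    (hx : IsLUB (Set.range u) x) : IsLUB (Set.range fun n => a + u n) (a + x) :=
  IsCuSemigroup.sup_add (fun _ => a) u monotone_const hu a x (by simp) hx

theorem exists_wayBelow_seq_mem {D : Set S} (h : ∀ y, y ≪ x → ∃ z ∈ D, y ≤ z ∧ z ≪ x) :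
    ∃ d : ℕ → S, (∀ n, d n ∈ D) ∧ (∀ n, d n ≪ d (n + 1)) ∧ IsLUB (Set.range d) x := by
  obtain ⟨v, hv, hvx⟩ := IsCuSemigroup.exists_wayBelow_seq x
  have hvm := monotone_of_wayBelow_succ hv
  have step (n : ℕ) (y : S) (hy : y ∈ D ∧ y ≪ x) : ∃ z, (z ∈ D ∧ z ≪ x) ∧ y ≪ z ∧ v n ≤ z := by
    obtain ⟨m, hm⟩ := hy.2.exists_wayBelow_term hvm hvx
    obtain ⟨z, hzD, hz, hzx⟩ := h (v (max m n)) (wayBelow_of_isLUB hv hvx _)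
    exact ⟨z, ⟨hzD, hzx⟩, hm.trans_le ((hvm (le_max_left m n)).trans hz),
      (hvm (le_max_right m n)).trans hz⟩
  obtain ⟨z₀, hz₀D, -, hz₀x⟩ := h 0 (zero_wayBelow x)
  obtain ⟨d, -, hd, hsucc⟩ := exists_seq_of_forall_exists step ⟨hz₀D, hz₀x⟩
  refine ⟨d, fun n => (hd n).1, fun n => (hsucc n).1,
    Set.forall_mem_range.2 fun n => (hd n).2.le, fun b hb => hvx.2 ?_⟩
  exact Set.forall_mem_range.2 fun n => (hsucc n).2.trans (hb ⟨n + 1, rfl⟩)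

theorem WayBelow.exists_chain (h : x ≪ y) :
    ∃ u : ℕ → S, u 0 = x ∧ (∀ n, u n ≪ y) ∧ ∀ n, u n ≪ u (n + 1) :=
  exists_seq_of_forall_exists (p := (· ≪ y)) (r := fun _ => WayBelow)
    (fun _ _ ha => ha.exists_between.imp fun _ => And.symm) h

theorem CountablyBased.exists_seq_le_of_ne_zero (h : CountablyBased S) :
    ∃ t : ℕ → S, ∀ x ≠ 0, ∃ n, t n ≠ 0 ∧ t n ≤ x := by
  obtain ⟨D, hD, hdense⟩ := h
  obtain ⟨t, rfl⟩ := hD.exists_eq_range ((hdense 0 0 (zero_wayBelow 0)).imp fun _ => And.left)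
  refine ⟨t, fun x hx => ?_⟩
  obtain ⟨x', hx'0, hx'⟩ := exists_ne_zero_wayBelow hx
  obtain ⟨_, ⟨n, rfl⟩, hle, hlt⟩ := hdense x' x hx'
  exact ⟨n, ne_zero_of_le hx'0 hle, hlt.le⟩

theorem CountablyBased.exists_countable_subset (h : CountablyBased S) {B : Set S}
    (hB : IsSupDense B) : ∃ D ⊆ B, D.Countable ∧ IsSupDense D := by
  obtain ⟨E, hE, hdense⟩ := h
  have hex (e e' : S) : ∃ b, e ≪ e' → b ∈ B ∧ e ≤ b ∧ b ≪ e' := by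
    by_cases h : e ≪ e'
    · exact (hB e e' h).imp fun _ hb _ => hb
    · exact ⟨0, fun h' => absurd h' h⟩
  choose f hf using hex
  refine ⟨Function.uncurry f '' {p ∈ E ×ˢ E | p.1 ≪ p.2}, ?_, ?_, fun x' x hx => ?_⟩
  · rintro _ ⟨p, hp, rfl⟩
    exact (hf p.1 p.2 hp.2).1
  · exact ((hE.prod hE).mono fun _ => And.left).image _
  · obtain ⟨y, hx'y, hyx⟩ := hx.exists_between
    obtain ⟨d, hd, hx'd, hdy⟩ := hdense x' y hx'y
    obtain ⟨e, he, hye, hex⟩ := hdense y x hyx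
    have hde : d ≪ e := hdy.trans_le hye
    exact ⟨f d e, ⟨(d, e), ⟨⟨hd, he⟩, hde⟩, rfl⟩, hx'd.trans (hf d e hde).2.1,
      (hf d e hde).2.2.trans hex⟩

end Basic

section Simple

variable {S : Type*} [AddCommMonoid S] [PartialOrder S]

variable (S) in
/-- The nonzero elements of `S` are downward directed. This is the form in which (O6) is used for
simple semigroups. -/
def NonzeroDirected : Prop :=
  ∀ x y : S, x ≠ 0 → y ≠ 0 → ∃ v, v ≠ 0 ∧ v ≤ x ∧ v ≤ y

variable [IsCuSemigroup S] {x x' y : S}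

/-- The ideal generated by `y`. -/
def idealSpan (y : S) : AddSubmonoid S where
  carrier := {x | ∀ x', x' ≪ x → ∃ n : ℕ, x' ≤ n • y}
  zero_mem' := fun x' hx' => ⟨0, by simpa using hx'.le⟩
  add_mem' := by
    intro a b ha hb x' hx'
    obtain ⟨a', b', ha', hb', hle⟩ := exists_le_add_of_wayBelow_add hx'
    obtain ⟨m, hm⟩ := ha a' ha'
    obtain ⟨n, hn⟩ := hb b' hb'
    exact ⟨m + n, hle.trans (add_nsmul y m n ▸ add_le_add hm hn)⟩

theorem isIdeal_idealSpan (y : S) : IsIdeal (idealSpan y) := by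
  refine ⟨fun a b hab hb x' hx' => hb x' (hx'.trans_le hab), fun u hu hmem s hs x' hx' => ?_⟩
  obtain ⟨n, hn⟩ := hx'.exists_wayBelow_term hu hs
  exact hmem n x' hn

theorem mem_idealSpan_self (y : S) : y ∈ idealSpan y := fun _ hy' => ⟨1, by simpa using hy'.le⟩

theorem Simple.exists_le_nsmul (hS : Simple S) (hy : y ≠ 0) (h : x' ≪ x) :
    ∃ n : ℕ, x' ≤ n • y := by
  rcases hS _ (isIdeal_idealSpan y) with hI | hI
  · exact absurd (AddSubmonoid.mem_bot.1 (hI ▸ mem_idealSpan_self y)) hy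
  · exact (hI ▸ AddSubmonoid.mem_top x : x ∈ idealSpan y) x' h

theorem Simple.le_of_forall_nsmul_le (hS : Simple S) (hy : y ≠ 0) (h : ∀ n : ℕ, n • y ≤ x)
    (q : S) : q ≤ x :=
  le_of_forall_wayBelow fun _ hq' =>
    let ⟨n, hn⟩ := hS.exists_le_nsmul hy hq'
    hn.trans (h n)

theorem O6.exists_ne_zero_le_of_le_nsmul (hO6 : O6 S) (n : ℕ) (hx : x ≠ 0) (h : x ≤ n • y) :
    ∃ v, v ≠ 0 ∧ v ≤ x ∧ v ≤ y := by
  induction n generalizing x with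
  | zero => exact absurd (zero_nsmul y ▸ h).eq_zero hx
  | succ n ih =>
    obtain ⟨x', hx'0, hx'⟩ := exists_ne_zero_wayBelow hx
    obtain ⟨v, w, hvx, hvy, hwx, hwy, hle⟩ := hO6 x' x (n • y) y hx' (succ_nsmul y n ▸ h)
    by_cases hv : v = 0
    · exact ⟨w, ne_zero_of_le hx'0 (by simpa [hv] using hle), hwx, hwy⟩
    · obtain ⟨v', hv'0, hv'v, hv'y⟩ := ih hv hvy
      exact ⟨v', hv'0, hv'v.trans hvx, hv'y⟩

theorem Simple.nonzeroDirected (hS : Simple S) (hO6 : O6 S) : NonzeroDirected S := by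
  intro x y hx hy
  obtain ⟨x', hx'0, hx'⟩ := exists_ne_zero_wayBelow hx
  obtain ⟨n, hn⟩ := hS.exists_le_nsmul hy hx'
  obtain ⟨v, hv0, hvx', hvy⟩ := hO6.exists_ne_zero_le_of_le_nsmul n hx'0 hn
  exact ⟨v, hv0, hvx'.trans hx'.le, hvy⟩

end Simple

section Soft

variable {S : Type*} [AddCommMonoid S] [PartialOrder S] {x x' y : S}

theorem IsSoft.exists_add_wayBelow (hx : IsSoft x) (hx0 : x ≠ 0) (h : x' ≪ x) :
    ∃ t, t ≠ 0 ∧ x' + t ≪ x :=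
  (hx.resolve_left hx0).2 x' h

variable [IsCuSemigroup S]

theorem IsSoft.add_left_of_ne_zero (hx : IsSoft x) (hx0 : x ≠ 0) (y : S) : IsSoft (y + x) := by
  refine Or.inr ⟨fun h => hx0 (add_eq_zero_iff_eq_zero.1 h).2, fun z hz => ?_⟩
  obtain ⟨y', x', hy', hx', hle⟩ := exists_le_add_of_wayBelow_add hz
  obtain ⟨t, ht0, ht⟩ := hx.exists_add_wayBelow hx0 hx'
  refine ⟨t, ht0, ?_⟩
  calc z + t ≤ y' + x' + t := by gcongr
    _ = y' + (x' + t) := add_assoc _ _ _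
    _ ≪ y + x := hy'.add ht

theorem isSoft_of_isLUB {u : ℕ → S} (hu : Monotone u) (hsoft : ∀ n, IsSoft (u n))
    (hx : IsLUB (Set.range u) x) : IsSoft x := by
  refine or_iff_not_imp_left.2 fun hx0 => ⟨hx0, fun x' hx' => ?_⟩
  obtain ⟨y, hy0, hy⟩ := exists_ne_zero_wayBelow hx0
  obtain ⟨n, hn⟩ := hx'.exists_wayBelow_term hu hx
  obtain ⟨m, hm⟩ := hy.exists_wayBelow_term hu hx
  have hne : u (max n m) ≠ 0 := ne_zero_of_le hy0 (hm.le.trans (hu (le_max_right _ _)))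
  obtain ⟨t, ht0, ht⟩ := (hsoft (max n m)).exists_add_wayBelow hne
    (hn.trans_le (hu (le_max_left _ _)))
  exact ⟨t, ht0, ht.trans_le (hx.1 ⟨_, rfl⟩)⟩

theorem IsSoft.eq_zero_of_isCompactElt (hc : WeaklyCancellative S) (hx : IsSoft x)
    (h : IsCompactElt x) : x = 0 := by
  by_contra hx0
  obtain ⟨t, ht0, ht⟩ := hx.exists_add_wayBelow hx0 h
  have ht : x + t ≪ x + 0 := by rwa [add_zero]
  exact ht0 (hc.cancel_left ht).le.eq_zero

theorem IsSoft.exists_ne_zero_add_self_le (hdir : NonzeroDirected S) (hx : IsSoft x)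
    (hx0 : x ≠ 0) : ∃ s, s ≠ 0 ∧ s + s ≤ x := by
  obtain ⟨y, hy0, hy⟩ := exists_ne_zero_wayBelow hx0
  obtain ⟨t, ht0, ht⟩ := hx.exists_add_wayBelow hx0 hy
  obtain ⟨s, hs0, hsy, hst⟩ := hdir y t hy0 ht0
  exact ⟨s, hs0, (add_le_add hsy hst).trans ht.le⟩

theorem IsSoft.le_of_forall_wayBelow_add (hc : WeaklyCancellative S) (hx : IsSoft x)
    (h : ∀ t ≠ 0, x ≪ y + t) : x ≤ y := by
  by_cases hx0 : x = 0
  · exact hx0 ▸ zero_le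
  refine le_of_forall_wayBelow fun x' hx' => ?_
  obtain ⟨t, ht0, ht⟩ := hx.exists_add_wayBelow hx0 hx'
  exact (hc _ _ t (ht.trans (h t ht0))).le

theorem IsSoft.le_of_add_le_add_right (hc : WeaklyCancellative S) {z : S} (hx : IsSoft x)
    (hthin : HasThinBoundary (y + z)) (h : x + z ≤ y + z) : x ≤ y :=
  hx.le_of_forall_wayBelow_add hc fun t ht0 => hc _ _ z <|
    calc x + z ≤ y + z := h
      _ ≪ y + z + t := hthin t ht0
      _ = y + t + z := add_right_comm _ _ _

end Soft

section Dimension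

variable {S : Type*} [AddCommMonoid S] [PartialOrder S]

theorem dim_eq_zero_iff : dim S = 0 ↔ DimLE S 0 := by
  rw [dim, ENat.sInf_eq_zero]
  simp [eq_comm (a := (0 : ℕ∞))]

theorem DimLE.exists_wayBelow_add (h : DimLE S 0) {x' x y₁ y₂ : S} (hx : x' ≪ x)
    (hxy : x ≪ y₁ + y₂) : ∃ z₁ z₂, z₁ ≪ y₁ ∧ z₂ ≪ y₂ ∧ x' ≪ z₁ + z₂ ∧ z₁ + z₂ ≪ x := by
  obtain ⟨z, hzy, hxz, hzx⟩ := h x' x 2 ![y₁, y₂] hx (by simpa using hxy)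
  exact ⟨z 0 0, z 1 0, hzy 0 0, hzy 1 0, by simpa using hxz, by simpa using hzx 0⟩

end Dimension

section ZeroDimensional

variable {S : Type*} [AddCommMonoid S] [PartialOrder S] [IsCuSemigroup S]

theorem Simple.exists_wayBelow_le_add (hS : Simple S) {v v' t : S} (hv : v ≪ v')
    (ht : t ≠ 0) : ∃ e' e, v ≤ e' ∧ e' ≪ e ∧ e ≤ e' + t := by
  obtain ⟨x, hx0, hx⟩ := exists_ne_zero_wayBelow ht
  obtain ⟨N, hN⟩ := hS.exists_le_nsmul hx0 hv
  obtain ⟨u, rfl, hut, hu⟩ := hx.exists_chain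
  -- The sum of a long chain below `t` and the sum of its shift differ only in their end terms.
  refine ⟨∑ i ∈ Finset.range N, u i, ∑ i ∈ Finset.range N, u (i + 1), ?_,
    .sum _ fun i _ => hu i, ?_⟩
  · calc v ≤ N • u 0 := hN
      _ = ∑ _i ∈ Finset.range N, u 0 := by simp
      _ ≤ ∑ i ∈ Finset.range N, u i :=
        Finset.sum_le_sum fun i _ => monotone_of_wayBelow_succ hu (Nat.zero_le i)
  · calc ∑ i ∈ Finset.range N, u (i + 1)
        ≤ ∑ i ∈ Finset.range N, u (i + 1) + u 0 := le_add_of_nonneg_right zero_le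
      _ = ∑ i ∈ Finset.range N, u i + u N := by
        rw [← Finset.sum_range_succ', Finset.sum_range_succ]
      _ ≤ ∑ i ∈ Finset.range N, u i + t := by gcongr; exact (hut N).le

theorem DimLE.exists_wayBelow_add_of_large (hdim : DimLE S 0) (hc : WeaklyCancellative S)
    (hO5 : O5 S) {a v e' e s : S} (hav : a ≪ v) (hve : v ≤ e') (he : e' ≪ e) (hes : e ≤ e' + s) :
    ∃ w' w, w' ≪ w ∧ w ≪ v ∧ a ≪ w' + s ∧ w ≪ w' + s := by
  obtain ⟨b, hab, hbv⟩ := hav.exists_between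
  obtain ⟨c, hbce, hevc, -⟩ := hO5 b v 0 0 e (by rw [add_zero]; exact hve.trans he.le) hbv
    (zero_wayBelow 0)
  obtain ⟨d, he'd, hde⟩ := he.exists_between
  obtain ⟨w, z, hwv, hzc, he'wz, hwzd⟩ := hdim.exists_wayBelow_add he'd (hde.trans_le hevc)
  obtain ⟨w', hw', he'w'z⟩ := he'wz.exists_wayBelow_add_left
  have hle : e ≤ w' + s + z :=
    calc e ≤ e' + s := hes
      _ ≤ w' + z + s := by gcongr; exact he'w'z.le
      _ = w' + s + z := add_right_comm _ _ _
  refine ⟨w', w, hw', hwv, hc _ _ z ?_, hc _ _ z ((hwzd.trans hde).trans_le hle)⟩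
  calc a + z ≪ b + c := hab.add hzc
    _ ≤ e := hbce
    _ ≤ w' + s + z := hle

theorem DimLE.exists_wayBelow_add_between (hdim : DimLE S 0) (hS : Simple S)
    (hc : WeaklyCancellative S) (hO5 : O5 S) (hdir : NonzeroDirected S) {u v t : S}
    (hv : IsSoft v) (huv : u ≪ v) (ht : t ≠ 0) :
    ∃ w' w, u ≪ w' ∧ w' ≪ w ∧ w ≪ v ∧ w ≪ w' + t := by
  by_cases hv0 : v = 0
  · have hu0 : u = 0 := (hv0 ▸ huv.le).eq_zero
    exact ⟨0, 0, by rw [hu0]; exact zero_wayBelow 0, zero_wayBelow 0, zero_wayBelow v,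
      zero_wayBelow _⟩
  obtain ⟨τ, hτ0, huτ⟩ := hv.exists_add_wayBelow hv0 huv
  obtain ⟨s, hs0, hsτ, hst⟩ := hdir τ t hτ0 ht
  have hus : u + s ≪ v := huτ.le_trans (by gcongr)
  obtain ⟨v', husv', hv'v⟩ := hus.exists_between
  obtain ⟨e', e, hv'e', he'e, hee'⟩ := hS.exists_wayBelow_le_add hv'v hs0
  obtain ⟨w', w, hw'w, hwv', husw', hww'⟩ :=
    hdim.exists_wayBelow_add_of_large hc hO5 husv' hv'e' he'e hee'
  exact ⟨w', w, hc _ _ s husw', hw'w, hwv'.trans hv'v, hww'.trans_le (by gcongr)⟩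

theorem hasThinBoundary_of_nested {t u v : ℕ → S} (ht : ∀ x ≠ 0, ∃ n, t n ≠ 0 ∧ t n ≤ x) {b : S}
    (hub : ∀ n, u n ≤ b) (hbv : ∀ n, b ≤ v n) (hvu : ∀ n, t n ≠ 0 → v n ≪ u n + t n) :
    HasThinBoundary b := by
  intro x hx
  obtain ⟨n, hn0, hnx⟩ := ht x hx
  calc b ≤ v n := hbv n
    _ ≪ u n + t n := hvu n hn0
    _ ≤ b + x := add_le_add (hub n) hnx

theorem DimLE.isSupDense_hasThinBoundary (hdim : DimLE S 0) (hbased : CountablyBased S)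
    (hS : Simple S) (hsoft : Soft S) (hc : WeaklyCancellative S) (hO5 : O5 S)
    (hdir : NonzeroDirected S) : IsSupDense {x : S | HasThinBoundary x} := by
  intro x' x hx
  obtain ⟨t, ht⟩ := hbased.exists_seq_le_of_ne_zero
  have step (n : ℕ) (p : S × S) (hp : p.1 ≪ p.2) : ∃ q : S × S, q.1 ≪ q.2 ∧
      p.1 ≪ q.1 ∧ q.2 ≪ p.2 ∧ (t n ≠ 0 → q.2 ≪ q.1 + t n) := by
    by_cases hn0 : t n = 0
    · obtain ⟨w', huw', hw'v⟩ := hp.exists_between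
      obtain ⟨w, hw'w, hwv⟩ := hw'v.exists_between
      exact ⟨(w', w), hw'w, huw', hwv, fun h => absurd hn0 h⟩
    · obtain ⟨w', w, huw', hw'w, hwv, hww'⟩ :=
        hdim.exists_wayBelow_add_between hS hc hO5 hdir (hsoft p.2) hp hn0
      exact ⟨(w', w), hw'w, huw', hwv, fun _ => hww'⟩
  obtain ⟨p, hp₀, hp, hsucc⟩ := exists_seq_of_forall_exists step (a := (x', x)) hx
  have hlow : Monotone fun n => (p n).1 := monotone_nat_of_le_succ fun n => (hsucc n).1.le
  have hupp : Antitone fun n => (p n).2 := antitone_nat_of_succ_le fun n => (hsucc n).2.1.le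
  obtain ⟨b, hb⟩ := IsCuSemigroup.exists_sup _ hlow
  have hlow_le (n : ℕ) : (p n).1 ≤ b := hb.1 ⟨n, rfl⟩
  have hle_upp (n : ℕ) : b ≤ (p n).2 := hb.2 <| Set.forall_mem_range.2 fun m =>
    hlow.forall_le_of_antitone hupp (fun k => (hp k).le) m n
  refine ⟨b, hasThinBoundary_of_nested ht (fun n => hlow_le (n + 1)) (fun n => hle_upp (n + 1))
    fun n => (hsucc n).2.2, ?_, ?_⟩
  · simpa [hp₀] using hlow_le 0
  · simpa [hp₀] using (hsucc 0).2.1.le_trans (hle_upp 1)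

end ZeroDimensional

section ThinBoundary

variable {S : Type*} [AddCommMonoid S] [PartialOrder S] {a b : S}

theorem HasThinBoundary.of_add_left (hc : WeaklyCancellative S) (h : HasThinBoundary (a + b)) :
    HasThinBoundary b := fun t ht =>
  hc.cancel_left (z := a) (by rw [← add_assoc]; exact h t ht)

variable [IsCuSemigroup S]

theorem HasThinBoundary.zero : HasThinBoundary (0 : S) := fun _ _ => zero_wayBelow _

theorem HasThinBoundary.add (hsoft : Soft S) (hdir : NonzeroDirected S) (ha : HasThinBoundary a)
    (hb : HasThinBoundary b) : HasThinBoundary (a + b) := by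
  intro t ht
  obtain ⟨s, hs0, hst⟩ := (hsoft t).exists_ne_zero_add_self_le hdir ht
  calc a + b ≪ a + s + (b + s) := (ha s hs0).add (hb s hs0)
    _ = a + b + (s + s) := add_add_add_comm _ _ _ _
    _ ≤ a + b + t := by gcongr

theorem HasThinBoundary.exists_le_add_wayBelow (hc : WeaklyCancellative S) (hO5 : O5 S)
    {s u : S} (ha : HasThinBoundary a) (hs : IsSoft s) (hs0 : s ≠ 0) (hau : a ≤ u)
    (hus : u ≪ s) : ∃ c, u ≤ a + c ∧ a + c ≪ s := by
  obtain ⟨t, ht0, ht⟩ := hs.exists_add_wayBelow hs0 hus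
  obtain ⟨z, hutz, hzs⟩ := ht.exists_between
  have hatz : a + t + 0 ≤ z :=
    calc a + t + 0 = a + t := add_zero _
      _ ≤ u + t := by gcongr
      _ ≤ z := hutz.le
  obtain ⟨c, hacz, hzatc, -⟩ := hO5 a (a + t) 0 0 z hatz (ha t ht0) (zero_wayBelow 0)
  refine ⟨c, (hc _ _ t ?_).le, hzs.le_trans hacz⟩
  calc u + t ≪ z := hutz
    _ ≤ a + t + c := hzatc
    _ = a + c + t := add_right_comm _ _ _

theorem HasThinBoundary.exists_add_eq (hc : WeaklyCancellative S) (hO5 : O5 S) {s : S}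
    (ha : HasThinBoundary a) (hs : IsSoft s) (has : a ≪ s) : ∃ c, a + c = s := by
  by_cases hs0 : s = 0
  · subst hs0
    exact ⟨0, by rw [add_zero, has.le.eq_zero]⟩
  have happrox (y : S) (hy : y ≪ s) : ∃ z ∈ Set.range (a + ·), y ≤ z ∧ z ≪ s := by
    obtain ⟨u, hu, hus⟩ := IsCuSemigroup.exists_wayBelow_seq s
    have hum := monotone_of_wayBelow_succ hu
    obtain ⟨m, hm⟩ := has.exists_wayBelow_term hum hus
    obtain ⟨n, hn⟩ := hy.exists_wayBelow_term hum hus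
    obtain ⟨c, huc, hcs⟩ := ha.exists_le_add_wayBelow hc hO5 hs hs0
      (hm.le.trans (hum (le_max_left m n))) (wayBelow_of_isLUB hu hus _)
    exact ⟨a + c, ⟨c, rfl⟩, (hn.le.trans (hum (le_max_right m n))).trans huc, hcs⟩
  obtain ⟨d, hd, hdd, hds⟩ := exists_wayBelow_seq_mem happrox
  choose c hcd using hd
  obtain rfl : (fun n => a + c n) = d := funext hcd
  have hcm := monotone_of_wayBelow_succ fun n => hc.cancel_left (hdd n)
  obtain ⟨r, hr⟩ := IsCuSemigroup.exists_sup c hcm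
  exact ⟨r, (isLUB_range_const_add a hcm hr).unique hds⟩

theorem HasThinBoundary.exists_add_eq_of_wayBelow_add
    (hdense : IsSupDense {x : S | HasThinBoundary x}) (hsoft : Soft S)
    (hc : WeaklyCancellative S) (hO5 : O5 S) (hO6 : O6 S) {y z : S} (hb : HasThinBoundary b)
    (h : b ≪ y + z) :
    ∃ v w, HasThinBoundary v ∧ HasThinBoundary w ∧ v + w = b ∧ v ≪ y ∧ w ≪ z := by
  by_cases hz : z = 0
  · subst hz
    exact ⟨b, 0, hb, .zero, add_zero b, by simpa using h, zero_wayBelow 0⟩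
  obtain ⟨y', z', hy', hz', hle⟩ := exists_le_add_of_wayBelow_add h
  obtain ⟨t, ht0, ht⟩ := (hsoft z).exists_add_wayBelow hz hz'
  obtain ⟨x, hxb, hbx⟩ := (hb t ht0).exists_wayBelow_add_left
  obtain ⟨x₁, hxx₁, hx₁b⟩ := hxb.exists_between
  obtain ⟨p, q, hpb, hpy, -, hqz, hx₁pq⟩ := hO6 x₁ b y' z' hx₁b hle
  obtain ⟨p', hp'p, hxp'q⟩ := (hxx₁.trans_le hx₁pq).exists_wayBelow_add_left
  obtain ⟨v, hv, hp'v, hvp⟩ := hdense p' p hp'p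
  obtain ⟨w, rfl⟩ := hv.exists_add_eq hc hO5 (hsoft b) (hvp.trans_le hpb)
  have hwqt : v + w ≪ v + (q + t) :=
    calc v + w ≪ x + t := hbx
      _ ≤ p' + q + t := by gcongr; exact hxp'q.le
      _ ≤ v + q + t := by gcongr
      _ = v + (q + t) := add_assoc _ _ _
  refine ⟨v, w, hv, hb.of_add_left hc, rfl, hvp.trans_le (hpy.trans hy'.le), ?_⟩
  calc w ≪ q + t := hc.cancel_left hwqt
    _ ≤ z' + t := by gcongr
    _ ≪ z := ht

theorem HasThinBoundary.exists_sum_eq_of_wayBelow_sum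
    (hdense : IsSupDense {x : S | HasThinBoundary x}) (hsoft : Soft S)
    (hc : WeaklyCancellative S) (hO5 : O5 S) (hO6 : O6 S) {r : ℕ} (y : Fin r → S)
    (hb : HasThinBoundary b) (h : b ≪ ∑ j, y j) :
    ∃ z : Fin r → S, (∀ j, z j ≪ y j) ∧ ∑ j, z j = b := by
  induction r generalizing b with
  | zero => exact ⟨0, fun j => j.elim0, by simpa using h.le.eq_zero.symm⟩
  | succ r ih =>
    rw [Fin.sum_univ_succ] at h
    obtain ⟨v, w, -, hw, rfl, hvy, hwy⟩ :=
      hb.exists_add_eq_of_wayBelow_add hdense hsoft hc hO5 hO6 h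
    obtain ⟨z, hzy, rfl⟩ := ih _ hw hwy
    exact ⟨Fin.cons v z, Fin.cases hvy hzy, by simp [Fin.sum_univ_succ]⟩

theorem dimLE_zero_of_isSupDense_hasThinBoundary
    (hdense : IsSupDense {x : S | HasThinBoundary x}) (hsoft : Soft S)
    (hc : WeaklyCancellative S) (hO5 : O5 S) (hO6 : O6 S) : DimLE S 0 := by
  intro x' x r y hx'x hxy
  obtain ⟨x₁, hx'x₁, hx₁x⟩ := hx'x.exists_between
  obtain ⟨b, hb, hx₁b, hbx⟩ := hdense x₁ x hx₁x
  obtain ⟨z, hzy, rfl⟩ :=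
    hb.exists_sum_eq_of_wayBelow_sum hdense hsoft hc hO5 hO6 y (hbx.trans hxy)
  exact ⟨fun j _ => z j, fun j _ => hzy j, by simpa using hx'x₁.trans_le hx₁b,
    fun _ => hbx⟩

end ThinBoundary

theorem IsSupDense.of_orderAddMonoidIso {S T : Type*} [AddCommMonoid S] [PartialOrder S]
    [AddCommMonoid T] [PartialOrder T] (h : IsSupDense {x : T | HasThinBoundary x})
    (e : S ≃+o T) : IsSupDense {x : S | HasThinBoundary x} := by
  have hsymm {y z : T} (hyz : y ≪ z) : e.symm y ≪ e.symm z :=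
    hyz.map_orderIso (e.symm : T ≃o S)
  intro x' x hx
  obtain ⟨b, hb, hxb, hbx⟩ := h (e x') (e x) (hx.map_orderIso (e : S ≃o T))
  refine ⟨e.symm b, fun t ht => ?_, (map_le_map_iff e).1 (by simpa using hxb), ?_⟩
  · simpa using hsymm (hb (e t) (by simpa using ht))
  · simpa using hsymm hbx

theorem exists_countable_closed {ι X : Type*} [Countable ι] {arity : ι → ℕ}
    (f : ∀ i, (Fin (arity i) → X) → X) {D : Set X} (hD : D.Countable) :
    ∃ M : Set X, M.Countable ∧ D ⊆ M ∧ ∀ i x, (∀ k, x k ∈ M) → f i x ∈ M := by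
  let L : FirstOrder.Language.{_, 0} := ⟨fun n => {i // arity i = n}, fun _ => Empty⟩
  let : L.Structure X := ⟨fun i x => f i.1 (x ∘ Fin.cast i.2), Empty.elim⟩
  have : Countable (Σ n, L.Functions n) := (Equiv.sigmaFiberEquiv arity).countable_iff.2 ‹_›
  let M := FirstOrder.Language.Substructure.closure L D
  exact ⟨M, hD.substructure_closure L, FirstOrder.Language.Substructure.subset_closure,
    fun i x hx => M.fun_mem (⟨i, rfl⟩ : L.Functions (arity i)) x hx⟩

section RieszSubmonoid

variable {S : Type*} [AddCommMonoid S] [PartialOrder S]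

/-- A submonoid in which way-below elements have complements and which satisfies Riesz
decomposition, both with respect to the relation `≪` of the ambient semigroup. -/
structure IsRieszSubmonoid (V : AddSubmonoid S) : Prop where
  exists_add_eq : ∀ a ∈ V, ∀ b ∈ V, a ≪ b → ∃ c ∈ V, a + c = b
  exists_add_eq_of_wayBelow_add : ∀ a ∈ V, ∀ y ∈ V, ∀ z ∈ V, a ≪ y + z →
    ∃ v ∈ V, ∃ w ∈ V, v + w = a ∧ v ≪ y ∧ w ≪ z

theorem IsRieszSubmonoid.exists_countable_le {V : AddSubmonoid S} (hV : IsRieszSubmonoid V)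
    {D : Set S} (hD : D.Countable) (hDV : D ⊆ V) :
    ∃ W ≤ V, (W : Set S).Countable ∧ D ⊆ W ∧ IsRieszSubmonoid W := by
  have hcompl (a b : V) (h : (a : S) ≪ b) : ∃ c : V, (a + c : S) = b := by
    simpa using hV.exists_add_eq a a.2 b b.2 h
  have hriesz (a y z : V) (h : (a : S) ≪ y + z) :
      ∃ v w : V, (v + w : S) = a ∧ (v : S) ≪ y ∧ (w : S) ≪ z := by
    obtain ⟨v, hv, w, hw, hvw⟩ := hV.exists_add_eq_of_wayBelow_add a a.2 y y.2 z z.2 h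
    exact ⟨⟨v, hv⟩, ⟨w, hw⟩, hvw⟩
  choose! compl hcompl using hcompl
  choose! left right hriesz using hriesz
  obtain ⟨M, hM, hDM, hclosed⟩ := exists_countable_closed (arity := fun _ => 3)
    ![fun x => x 0 + x 1, fun x => compl (x 0) (x 1), fun x => left (x 0) (x 1) (x 2),
      fun x => right (x 0) (x 1) (x 2)]
    ((hD.preimage Subtype.val_injective).insert (0 : V))
  have hclosed (i : Fin 4) {x y z : V} (hx : x ∈ M) (hy : y ∈ M) (hz : z ∈ M) :=
    hclosed i ![x, y, z] (by simp [Fin.forall_fin_succ, hx, hy, hz])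
  let W : AddSubmonoid V :=
    { carrier := M
      zero_mem' := hDM (Set.mem_insert _ _)
      add_mem' := fun ha hb => hclosed 0 ha hb hb }
  refine ⟨W.map V.subtype, ?_, hM.image _,
    fun d hd => ⟨⟨d, hDV hd⟩, hDM (Set.mem_insert_of_mem _ hd), rfl⟩, ?_, ?_⟩
  · rintro _ ⟨a, -, rfl⟩
    exact a.2
  · rintro _ ⟨a, ha, rfl⟩ _ ⟨b, hb, rfl⟩ hab
    exact ⟨_, ⟨_, hclosed 1 ha hb hb, rfl⟩, hcompl a b hab⟩
  · rintro _ ⟨a, ha, rfl⟩ _ ⟨y, hy, rfl⟩ _ ⟨z, hz, rfl⟩ h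
    exact ⟨_, ⟨_, hclosed 2 ha hy hz, rfl⟩, _, ⟨_, hclosed 3 ha hy hz, rfl⟩, hriesz a y z h⟩

variable [IsCuSemigroup S]

/-- The submonoid of elements with thin boundary. -/
def thinBoundary (hsoft : Soft S) (hdir : NonzeroDirected S) : AddSubmonoid S where
  carrier := {x | HasThinBoundary x}
  zero_mem' := .zero
  add_mem' := .add hsoft hdir

theorem isRieszSubmonoid_thinBoundary (hdense : IsSupDense {x : S | HasThinBoundary x})
    (hsoft : Soft S) (hc : WeaklyCancellative S) (hO5 : O5 S) (hO6 : O6 S)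
    (hdir : NonzeroDirected S) : IsRieszSubmonoid (thinBoundary hsoft hdir) where
  exists_add_eq a ha b hb hab := by
    obtain ⟨c, rfl⟩ := HasThinBoundary.exists_add_eq hc hO5 ha (hsoft b) hab
    exact ⟨c, HasThinBoundary.of_add_left hc hb, rfl⟩
  exists_add_eq_of_wayBelow_add a ha y _ z _ h := by
    obtain ⟨v, w, hv, hw, hvw⟩ :=
      HasThinBoundary.exists_add_eq_of_wayBelow_add hdense hsoft hc hO5 hO6 ha h
    exact ⟨v, hv, w, hw, hvw⟩

end RieszSubmonoid

/-- A countable, sup-dense Riesz submonoid of elements with thin boundary in a soft, weakly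
cancellative semigroup. Its elements become the compact elements of an algebraic `Cu`-semigroup
with soft part `S`. -/
structure CompactCore (S : Type*) [AddCommMonoid S] [PartialOrder S] extends AddSubmonoid S where
  soft : Soft S
  cancel : WeaklyCancellative S
  countable : carrier.Countable
  isSupDense : IsSupDense carrier
  thin : ∀ a ∈ toAddSubmonoid, HasThinBoundary a
  riesz : IsRieszSubmonoid toAddSubmonoid

theorem exists_compactCore {S : Type*} [AddCommMonoid S] [PartialOrder S] [IsCuSemigroup S]
    (hbased : CountablyBased S) (hdense : IsSupDense {x : S | HasThinBoundary x})
    (hsoft : Soft S) (hc : WeaklyCancellative S) (hO5 : O5 S) (hO6 : O6 S)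
    (hdir : NonzeroDirected S) : Nonempty (CompactCore S) := by
  obtain ⟨D, hDV, hD, hDdense⟩ := hbased.exists_countable_subset hdense
  obtain ⟨W, hWV, hW, hDW, hriesz⟩ :=
    (isRieszSubmonoid_thinBoundary hdense hsoft hc hO5 hO6 hdir).exists_countable_le hD hDV
  refine ⟨W, hsoft, hc, hW, fun x' x hx => ?_, fun a ha => hWV ha, hriesz⟩
  obtain ⟨d, hd, hdx⟩ := hDdense x' x hx
  exact ⟨d, hDW hd, hdx⟩

variable {S : Type*} [AddCommMonoid S] [PartialOrder S]

/-- The algebraic semigroup with compact elements `C` and soft part `S`: an element of `S` together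
with a tag that says whether it is regarded as compact. Zero only occurs as a compact element. -/
@[ext]
structure CompactCore.Extension (C : CompactCore S) where
  /-- The underlying element of `S`. -/
  val : S
  /-- Whether the element is regarded as compact. -/
  cpt : Prop
  mem : cpt → val ∈ C.toAddSubmonoid
  ne_zero : ¬ cpt → val ≠ 0

namespace CompactCore.Extension

variable {C : CompactCore S} {p q r : C.Extension}

theorem eq_of_cpt (hp : p.cpt) (hq : q.cpt) (h : p.val = q.val) : p = q :=
  Extension.ext h (propext ⟨fun _ => hq, fun _ => hp⟩)

theorem eq_of_not_cpt (hp : ¬ p.cpt) (hq : ¬ q.cpt) (h : p.val = q.val) : p = q :=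
  Extension.ext h (propext ⟨fun h => absurd h hp, fun h => absurd h hq⟩)

instance : Zero C.Extension := ⟨⟨0, True, fun _ => C.zero_mem, fun h => absurd trivial h⟩⟩

@[simp] theorem val_zero : (0 : C.Extension).val = 0 := rfl

@[simp] theorem cpt_zero : (0 : C.Extension).cpt := trivial

theorem eq_zero_of_val_eq_zero (h : p.val = 0) : p = 0 :=
  eq_of_cpt (by_contra fun hp => p.ne_zero hp h) trivial h

-- The second condition puts the soft copy of a nonzero compact element strictly below it.
instance : LE C.Extension :=
  ⟨fun p q => p.val ≤ q.val ∧ (p.cpt → p = q ∨ p.val ≪ q.val)⟩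

theorem val_le (h : p ≤ q) : p.val ≤ q.val := h.1

theorem eq_or_wayBelow (h : p ≤ q) (hp : p.cpt) : p = q ∨ p.val ≪ q.val := h.2 hp

theorem le_of_wayBelow (h : p.val ≪ q.val) : p ≤ q := ⟨h.le, fun _ => Or.inr h⟩

theorem le_of_not_cpt (hp : ¬ p.cpt) (h : p.val ≤ q.val) : p ≤ q := ⟨h, fun hp' => absurd hp' hp⟩

variable [IsCuSemigroup S]

theorem eq_of_cpt_of_le (hp : p.cpt) (hpq : p ≤ q) (hqp : q.val ≤ p.val) : p = q := by
  refine (eq_or_wayBelow hpq hp).elim id fun h => ?_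
  have hp0 : p.val = 0 := (C.soft p.val).eq_zero_of_isCompactElt C.cancel (h.trans_le hqp)
  have hq0 : q.val = 0 := (hqp.trans hp0.le).eq_zero
  rw [eq_zero_of_val_eq_zero hp0, eq_zero_of_val_eq_zero hq0]

instance : PartialOrder C.Extension where
  le_refl p := ⟨le_rfl, fun _ => Or.inl rfl⟩
  le_trans p q r hpq hqr := by
    refine ⟨(val_le hpq).trans (val_le hqr), fun hp => ?_⟩
    rcases eq_or_wayBelow hpq hp with rfl | h
    · exact eq_or_wayBelow hqr hp
    · exact Or.inr (h.trans_le (val_le hqr))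
  le_antisymm p q hpq hqp := by
    by_cases hp : p.cpt
    · exact eq_of_cpt_of_le hp hpq (val_le hqp)
    by_cases hq : q.cpt
    · exact (eq_of_cpt_of_le hq hqp (val_le hpq)).symm
    · exact eq_of_not_cpt hp hq (le_antisymm (val_le hpq) (val_le hqp))

instance : Add C.Extension :=
  ⟨fun p q => ⟨p.val + q.val, p.cpt ∧ q.cpt, fun h => C.add_mem (p.mem h.1) (q.mem h.2),
    fun h h0 => h ⟨by_contra fun hp => p.ne_zero hp (add_eq_zero_iff_eq_zero.1 h0).1,
      by_contra fun hq => q.ne_zero hq (add_eq_zero_iff_eq_zero.1 h0).2⟩⟩⟩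

@[simp] theorem val_add (p q : C.Extension) : (p + q).val = p.val + q.val := rfl

@[simp] theorem cpt_add : (p + q).cpt ↔ p.cpt ∧ q.cpt := Iff.rfl

instance : AddCommMonoid C.Extension where
  add_assoc p q r := Extension.ext (add_assoc _ _ _) (propext and_assoc)
  zero_add p := Extension.ext (zero_add _) (by simp)
  add_zero p := Extension.ext (add_zero _) (by simp)
  add_comm p q := Extension.ext (add_comm _ _) (propext and_comm)
  nsmul := nsmulRec

@[simp] theorem val_nsmul (n : ℕ) (p : C.Extension) : (n • p).val = n • p.val :=
  map_nsmul (⟨⟨val, val_zero⟩, val_add⟩ : C.Extension →+ S) n p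

theorem add_le_add_of_le (h : p ≤ q) (r : C.Extension) : p + r ≤ q + r := by
  refine ⟨add_le_add_left (val_le h) r.val, fun hpr => ?_⟩
  rcases eq_or_wayBelow h hpr.1 with rfl | hpq
  · exact Or.inl rfl
  by_cases hq : q.val = 0
  · have hp : p.val = 0 := (hpq.le.trans hq.le).eq_zero
    rw [eq_zero_of_val_eq_zero hp, eq_zero_of_val_eq_zero hq]
    exact Or.inl rfl
  obtain ⟨t, ht0, ht⟩ := (C.soft q.val).exists_add_wayBelow hq hpq
  refine Or.inr ?_
  calc (p + r).val ≪ p.val + r.val + t := C.thin _ ((p + r).mem hpr) t ht0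
    _ = p.val + t + r.val := add_right_comm _ _ _
    _ ≤ q.val + r.val := add_le_add_left ht.le _

instance : IsOrderedAddMonoid C.Extension where
  add_le_add_left _ _ h r := add_le_add_of_le h r

theorem val_monotone : Monotone (val : C.Extension → S) := fun _ _ => val_le

theorem exists_isLUB {u : ℕ → C.Extension} (hu : Monotone u) :
    ∃ p, IsLUB (Set.range u) p ∧ IsLUB (Set.range (val ∘ u)) p.val ∧
      (p.cpt → p ∈ Set.range u) := by
  by_cases h : ∃ n, ∀ m, u m ≤ u n
  · obtain ⟨n, hn⟩ := h
    have hgreatest : IsGreatest (Set.range u) (u n) := ⟨⟨n, rfl⟩, Set.forall_mem_range.2 hn⟩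
    refine ⟨u n, hgreatest.isLUB, ?_, fun _ => ⟨n, rfl⟩⟩
    rw [Set.range_comp]
    exact (val_monotone.map_isGreatest hgreatest).isLUB
  push Not at h
  obtain ⟨s, hs⟩ := IsCuSemigroup.exists_sup _ (val_monotone.comp hu)
  have hus (n : ℕ) : (u n).val ≤ s := hs.1 ⟨n, rfl⟩
  have hs0 : s ≠ 0 := by
    rintro rfl
    have hu0 (n : ℕ) : u n = 0 := eq_zero_of_val_eq_zero (hus n).eq_zero
    obtain ⟨m, hm⟩ := h 0
    exact hm (by rw [hu0, hu0])
  refine ⟨⟨s, False, False.elim, fun _ => hs0⟩, ⟨?_, fun w hw => ?_⟩, hs, False.elim⟩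
  · rintro _ ⟨n, rfl⟩
    refine ⟨hus n, fun hcpt => Or.inr ?_⟩
    obtain ⟨m, hm⟩ := h n
    rcases eq_or_wayBelow (hu (le_max_left n m)) hcpt with heq | hlt
    · exact absurd ((hu (le_max_right n m)).trans heq.ge) hm
    · exact hlt.trans_le (hus _)
  · exact le_of_not_cpt id (hs.2 (Set.forall_mem_range.2 fun n => val_le (hw ⟨n, rfl⟩)))

theorem isLUB_val {u : ℕ → C.Extension} (hu : Monotone u) (hp : IsLUB (Set.range u) p) :
    IsLUB (Set.range (val ∘ u)) p.val := by
  obtain ⟨q, hq, hval, -⟩ := exists_isLUB hu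
  rwa [hp.unique hq]

theorem mem_range_of_isLUB {u : ℕ → C.Extension} (hu : Monotone u)
    (hp : IsLUB (Set.range u) p) (hcpt : p.cpt) : p ∈ Set.range u := by
  obtain ⟨q, hq, -, hmem⟩ := exists_isLUB hu
  obtain rfl := hp.unique hq
  exact hmem hcpt

theorem wayBelow_of_val (h : p.val ≪ q.val) : p ≪ q := by
  intro u hu s hs hq
  obtain ⟨n, hn⟩ :=
    (h.trans_le (val_le hq)).exists_wayBelow_term (val_monotone.comp hu) (isLUB_val hu hs)
  exact ⟨n, le_of_wayBelow hn⟩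

theorem isCompactElt_of_cpt (hp : p.cpt) : IsCompactElt p := by
  intro u hu s hs hps
  rcases eq_or_wayBelow hps hp with rfl | h
  · obtain ⟨n, hn⟩ := mem_range_of_isLUB hu hs hp
    exact ⟨n, hn.ge⟩
  · exact wayBelow_of_val h u hu s hs le_rfl

/-- The compact element given by an element of the core. -/
def ofMem {x : S} (hx : x ∈ C.toAddSubmonoid) : C.Extension :=
  ⟨x, True, fun _ => hx, fun h => absurd trivial h⟩

theorem exists_cpt_seq (p : C.Extension) :
    ∃ u : ℕ → C.Extension, (∀ n, (u n).cpt) ∧ (∀ n, u n ≪ u (n + 1)) ∧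
      IsLUB (Set.range u) p := by
  by_cases hp : p.cpt
  · exact ⟨fun _ => p, fun _ => hp, fun _ => isCompactElt_of_cpt hp, by simp⟩
  obtain ⟨d, hd, hdd, hdp⟩ := exists_wayBelow_seq_mem fun y => C.isSupDense y p.val
  refine ⟨fun n => ofMem (hd n), fun _ => trivial, fun n => wayBelow_of_val (hdd n),
    Set.forall_mem_range.2 fun n => le_of_wayBelow (wayBelow_of_isLUB hdd hdp n),
    fun w hw => le_of_not_cpt hp (hdp.2 ?_)⟩
  exact Set.forall_mem_range.2 fun n => val_le (hw ⟨n, rfl⟩)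

theorem exists_cpt_between (h : p ≪ q) : ∃ c : C.Extension, c.cpt ∧ p ≤ c ∧ c ≤ q := by
  obtain ⟨u, hu, huu, huq⟩ := exists_cpt_seq q
  obtain ⟨n, hn⟩ := h u (monotone_of_wayBelow_succ huu) q huq le_rfl
  exact ⟨u n, hu n, hn, huq.1 ⟨n, rfl⟩⟩

instance : IsCuSemigroup C.Extension where
  zero_le p := le_of_wayBelow (zero_wayBelow p.val)
  exists_sup u hu := (exists_isLUB hu).imp fun _ => And.left
  exists_wayBelow_seq p := (exists_cpt_seq p).imp fun _ => And.right
  wayBelow_add x' x y' y hx hy := by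
    obtain ⟨c, hc, hxc, hcx⟩ := exists_cpt_between hx
    obtain ⟨d, hd, hyd, hdy⟩ := exists_cpt_between hy
    have hcd : c + d ≪ c + d := isCompactElt_of_cpt ⟨hc, hd⟩
    exact (hcd.trans_le (add_le_add hcx hdy)).le_trans (add_le_add hxc hyd)
  sup_add u v hu hv a b ha hb := by
    refine ⟨Set.forall_mem_range.2 fun n => add_le_add (ha.1 ⟨n, rfl⟩) (hb.1 ⟨n, rfl⟩),
      fun w hw => ?_⟩
    by_cases hab : (a + b).cpt
    · obtain ⟨m, rfl⟩ := mem_range_of_isLUB hu ha hab.1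
      obtain ⟨n, rfl⟩ := mem_range_of_isLUB hv hb hab.2
      calc u m + v n ≤ u (max m n) + v (max m n) :=
          add_le_add (hu (le_max_left m n)) (hv (le_max_right m n))
        _ ≤ w := hw ⟨_, rfl⟩
    · have hsup := IsCuSemigroup.sup_add _ _ (val_monotone.comp hu) (val_monotone.comp hv) _ _
        (isLUB_val hu ha) (isLUB_val hv hb)
      exact le_of_not_cpt hab (hsup.2 (Set.forall_mem_range.2 fun n => val_le (hw ⟨n, rfl⟩)))

theorem isSupDense_cpt : IsSupDense {p : C.Extension | p.cpt} := fun _ _ h => by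
  obtain ⟨c, hc, hpc, hcq⟩ := exists_cpt_between h
  exact ⟨c, hc, hpc, (isCompactElt_of_cpt hc).trans_le hcq⟩

theorem algebraic : Algebraic C.Extension := fun x' x h =>
  (isSupDense_cpt x' x h).imp fun _ hc => ⟨isCompactElt_of_cpt hc.1, hc.2⟩

theorem countablyBased : CountablyBased C.Extension :=
  ⟨{p | p.cpt}, Set.MapsTo.countable_of_injOn (fun p hp => p.mem hp)
    (fun _ hp _ hq h => eq_of_cpt hp hq h) C.countable, isSupDense_cpt⟩

theorem simple (hS : Simple S) : Simple C.Extension := by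
  intro I hI
  refine I.bot_or_exists_ne_zero.imp_right ?_
  rintro ⟨p, hpI, hp0⟩
  have hval : p.val ≠ 0 := fun h => hp0 (eq_zero_of_val_eq_zero h)
  have hcpt (c : C.Extension) (hc : c.cpt) : c ∈ I := by
    have hthin := C.thin _ (c.mem hc) _ hval
    obtain ⟨n, hn⟩ := hS.exists_le_nsmul hval hthin
    refine hI.1 c ((n + 1) • p) (le_of_wayBelow ?_) (I.nsmul_mem hpI _)
    calc c.val ≪ c.val + p.val := hthin
      _ ≤ n • p.val + p.val := add_le_add_left hn _
      _ = ((n + 1) • p).val := by rw [val_nsmul, succ_nsmul]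
  refine eq_top_iff.2 fun q _ => ?_
  obtain ⟨u, hu, huu, huq⟩ := exists_cpt_seq q
  exact hI.2 u (monotone_of_wayBelow_succ huu) (fun n => hcpt _ (hu n)) q huq

theorem weaklyCancellative : WeaklyCancellative C.Extension := by
  intro x y z h
  obtain ⟨c, hc, hxc, hcy⟩ := exists_cpt_between h
  rcases eq_or_wayBelow hcy hc with rfl | hlt
  · have hthin : HasThinBoundary (y.val + z.val) := C.thin _ ((y + z).mem hc)
    have hle : x.val ≤ y.val := (C.soft _).le_of_add_le_add_right C.cancel hthin (val_le hxc)
    have hxy : x ≤ y := by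
      refine ⟨hle, fun hx => ?_⟩
      refine (eq_or_wayBelow hxc ⟨hx, hc.2⟩).imp (fun heq => ?_) (C.cancel _ _ _)
      have hval : y.val + z.val = x.val + z.val := (congrArg val heq).symm
      exact eq_of_cpt hx hc.1 (le_antisymm hle
        ((C.soft _).le_of_add_le_add_right C.cancel (hval ▸ hthin) hval.le))
    exact WayBelow.le_trans hxy (isCompactElt_of_cpt hc.1)
  · exact wayBelow_of_val (C.cancel _ _ z.val (hlt.le_trans (val_le hxc)))

theorem exists_add_eq_of_cpt (hO5 : O5 S) (hp : p.cpt) (h : p ≤ q) : ∃ c, p + c = q := by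
  rcases eq_or_wayBelow h hp with rfl | hlt
  · exact ⟨0, add_zero p⟩
  by_cases hq : q.cpt
  · obtain ⟨c, hc, hpc⟩ := C.riesz.exists_add_eq _ (p.mem hp) _ (q.mem hq) hlt
    exact ⟨ofMem hc, eq_of_cpt ⟨hp, trivial⟩ hq hpc⟩
  · obtain ⟨c, hpc⟩ := (C.thin _ (p.mem hp)).exists_add_eq C.cancel hO5 (C.soft _) hlt
    have hc0 : c ≠ 0 := by
      rintro rfl
      rw [add_zero] at hpc
      exact q.ne_zero hq ((C.soft _).eq_zero_of_isCompactElt C.cancel (hpc ▸ hlt))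
    exact ⟨⟨c, False, False.elim, fun _ => hc0⟩, eq_of_not_cpt (fun h => h.2) hq hpc⟩

theorem o5 (hO5 : O5 S) : O5 C.Extension := by
  intro x' x y' y z hxyz hx hy
  obtain ⟨a, ha, hxa, hax⟩ := exists_cpt_between hx
  obtain ⟨b, hb, hyb, hby⟩ := exists_cpt_between hy
  obtain ⟨c, rfl⟩ := exists_add_eq_of_cpt hO5 (p := a + b) ⟨ha, hb⟩
    ((add_le_add hax hby).trans hxyz)
  rw [add_assoc]
  have hyb' : y' ≪ b := WayBelow.le_trans hyb (isCompactElt_of_cpt hb)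
  exact ⟨b + c, by gcongr, by gcongr, hyb'.trans_le (le_add_of_nonneg_right zero_le)⟩

theorem exists_cpt_le_add (hp : p.cpt) (h : p ≤ q + r) :
    ∃ b c : C.Extension, b.cpt ∧ c.cpt ∧ b ≤ q ∧ c ≤ r ∧ p ≤ b + c := by
  obtain ⟨q', r', hq', hr', hle⟩ :=
    exists_le_add_of_wayBelow_add ((isCompactElt_of_cpt hp).trans_le h)
  obtain ⟨b, hb, hqb, hbq⟩ := exists_cpt_between hq'
  obtain ⟨c, hc, hrc, hcr⟩ := exists_cpt_between hr'
  exact ⟨b, c, hb, hc, hbq, hcr, hle.trans (add_le_add hqb hrc)⟩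

theorem exists_add_eq_of_cpt_of_le_add (hp : p.cpt) (h : p ≤ q + r) :
    ∃ v w : C.Extension, v + w = p ∧ v ≤ q ∧ w ≤ r := by
  obtain ⟨b, c, hb, hc, hbq, hcr, hle⟩ := exists_cpt_le_add hp h
  rcases eq_or_wayBelow hle hp with rfl | hlt
  · exact ⟨b, c, rfl, hbq, hcr⟩
  obtain ⟨v, hv, w, hw, hvw, hvb, hwc⟩ :=
    C.riesz.exists_add_eq_of_wayBelow_add _ (p.mem hp) _ (b.mem hb) _ (c.mem hc) hlt
  exact ⟨ofMem hv, ofMem hw, eq_of_cpt ⟨trivial, trivial⟩ hp hvw,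
    (le_of_wayBelow hvb).trans hbq, (le_of_wayBelow hwc).trans hcr⟩

theorem o6 : O6 C.Extension := by
  intro x' x y z hx hxyz
  obtain ⟨a, ha, hxa, hax⟩ := exists_cpt_between hx
  obtain ⟨v, w, rfl, hvy, hwz⟩ := exists_add_eq_of_cpt_of_le_add ha (hax.trans hxyz)
  exact ⟨v, w, (le_add_of_nonneg_right zero_le).trans hax, hvy,
    (le_add_of_nonneg_left zero_le).trans hax, hwz, hxa⟩

/-- The embedding of `S` as the soft part. -/
def ofSoft (x : S) : C.Extension :=
  ⟨x, x = 0, fun h => h ▸ C.zero_mem, id⟩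

theorem ofSoft_le_ofSoft {x y : S} : (ofSoft x : C.Extension) ≤ ofSoft y ↔ x ≤ y := by
  refine ⟨val_le, fun h => ⟨h, fun hx => Or.inr ?_⟩⟩
  obtain rfl : x = 0 := hx
  exact zero_wayBelow y

theorem ofSoft_add (x y : S) : (ofSoft (x + y) : C.Extension) = ofSoft x + ofSoft y :=
  Extension.ext rfl (propext add_eq_zero_iff_eq_zero)

theorem isSoft_ofSoft (x : S) : IsSoft (ofSoft x : C.Extension) := by
  by_cases hx : x = 0
  · exact Or.inl (eq_zero_of_val_eq_zero hx)
  refine Or.inr ⟨fun h => hx (congrArg val h), fun p hp => ?_⟩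
  obtain ⟨c, hc, hpc, hcx⟩ := exists_cpt_between hp
  rcases eq_or_wayBelow hcx hc with rfl | hlt
  · exact absurd hc hx
  obtain ⟨t, ht0, ht⟩ := (C.soft x).exists_add_wayBelow hx hlt
  exact ⟨ofSoft t, fun h => ht0 (congrArg val h),
    wayBelow_of_val (WayBelow.le_trans (add_le_add_left (val_le hpc) t) ht)⟩

theorem ofSoft_val_of_isSoft (hp : IsSoft p) : ofSoft p.val = p := by
  by_cases hcpt : p.cpt
  · rw [hp.eq_zero_of_isCompactElt weaklyCancellative (isCompactElt_of_cpt hcpt)]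
    exact eq_zero_of_val_eq_zero rfl
  · exact eq_of_not_cpt (p.ne_zero hcpt) hcpt rfl

/-- The identification of `S` with the soft part of the extension. -/
def softEquiv (C : CompactCore S) : S ≃+o softPart C.Extension where
  toFun x := ⟨ofSoft x, isSoft_ofSoft x⟩
  invFun p := p.1.val
  left_inv _ := rfl
  right_inv p := Subtype.ext (ofSoft_val_of_isSoft p.2)
  map_add' x y := Subtype.ext (ofSoft_add x y)
  map_le_map_iff' := ofSoft_le_ofSoft

end CompactCore.Extension

section Algebraic

variable {T : Type*} [AddCommMonoid T] [PartialOrder T]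

variable (T) in
/-- Every nonzero compact element is the sum of two nonzero elements, so that there are no minimal
nonzero compact elements. -/
def CompactsSplit : Prop :=
  ∀ c : T, IsCompactElt c → c ≠ 0 → ∃ v r, v ≠ 0 ∧ r ≠ 0 ∧ v + r = c

theorem IsCompactElt.of_add_left (hc : WeaklyCancellative T) {a b : T}
    (h : IsCompactElt (a + b)) : IsCompactElt b := hc.cancel_left (z := a) h

variable [IsCuSemigroup T] {b c : T}

theorem Algebraic.exists_isCompactElt_le (halg : Algebraic T) {t : T} (ht : t ≠ 0) :
    ∃ c, IsCompactElt c ∧ c ≠ 0 ∧ c ≤ t := by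
  obtain ⟨x, hx0, hx⟩ := exists_ne_zero_wayBelow ht
  obtain ⟨c, hc, hxc, hct⟩ := halg x t hx
  exact ⟨c, hc, ne_zero_of_le hx0 hxc, hct.le⟩

theorem IsCompactElt.exists_add_eq (hO5 : O5 T) {a b : T} (ha : IsCompactElt a) (hab : a ≤ b) :
    ∃ c, a + c = b := by
  obtain ⟨c, hle, hge, -⟩ := hO5 a a 0 0 b (by rwa [add_zero]) ha (zero_wayBelow 0)
  exact ⟨c, le_antisymm hle hge⟩

theorem Simple.compactsSplit (hS : Simple T) (halg : Algebraic T) (hO5 : O5 T)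
    (hdir : NonzeroDirected T) {s q : T} (hs : IsSoft s) (hs0 : s ≠ 0) (hq : ¬ q ≤ s) :
    CompactsSplit T := by
  intro c hc hc0
  obtain ⟨k, hk, hk'⟩ : ∃ k : ℕ, k • c ≤ s ∧ ¬ (k + 1) • c ≤ s := by
    by_contra! h
    exact hq (hS.le_of_forall_nsmul_le hc0 (Nat.rec (by simp) h) q)
  obtain ⟨t, ht0, ht⟩ := hs.exists_add_wayBelow hs0 ((WayBelow.nsmul k hc).trans_le hk)
  obtain ⟨w, hw0, hwt, hwc⟩ := hdir t c ht0 hc0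
  obtain ⟨v, hv, hv0, hvw⟩ := halg.exists_isCompactElt_le hw0
  obtain ⟨r, rfl⟩ := hv.exists_add_eq hO5 (hvw.trans hwc)
  refine ⟨v, r, hv0, ?_, rfl⟩
  rintro rfl
  rw [add_zero] at hk hk' ht
  refine hk' ?_
  calc (k + 1) • v = k • v + v := succ_nsmul v k
    _ ≤ k • v + t := by gcongr; exact hvw.trans hwt
    _ ≤ s := ht.le

theorem CompactsSplit.exists_add_eq_of_ne_zero (hsplit : CompactsSplit T) (halg : Algebraic T)
    (hc : WeaklyCancellative T) (hO5 : O5 T) (hdir : NonzeroDirected T) {p t : T}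
    (hp : IsCompactElt p) (hp0 : p ≠ 0) (ht : t ≠ 0) :
    ∃ r p', r ≠ 0 ∧ r + p' = p ∧ IsCompactElt p' ∧ p' ≠ 0 ∧ p' ≤ t := by
  obtain ⟨w, hw0, hwp, hwt⟩ := hdir p t hp0 ht
  obtain ⟨e, he, he0, hew⟩ := halg.exists_isCompactElt_le hw0
  obtain ⟨q, rfl⟩ := he.exists_add_eq hO5 (hew.trans hwp)
  obtain ⟨v, p', hv0, hp'0, rfl⟩ := hsplit e he he0
  refine ⟨v + q, p', fun h => hv0 (add_eq_zero_iff_eq_zero.1 h).1, add_right_comm v q p',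
    he.of_add_left hc, hp'0, ?_⟩
  calc p' ≤ v + p' := le_add_of_nonneg_left zero_le
    _ ≤ t := hew.trans hwt

theorem monotone_of_add_le_succ {P : ℕ → T}
    (hadd : ∀ n, ∃ r, r ≠ 0 ∧ P n + r ≤ P (n + 1)) : Monotone P :=
  monotone_nat_of_le_succ fun n =>
    let ⟨_, _, hr⟩ := hadd n
    (le_add_of_nonneg_right zero_le).trans hr

theorem isSoft_of_isLUB_of_isCompactElt {P : ℕ → T} (hP : ∀ n, IsCompactElt (P n))
    (hadd : ∀ n, ∃ r, r ≠ 0 ∧ P n + r ≤ P (n + 1)) (hb : IsLUB (Set.range P) b) :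
    b ≠ 0 ∧ IsSoft b := by
  have hmono := monotone_of_add_le_succ hadd
  have hb0 : b ≠ 0 := by
    obtain ⟨r, hr0, hr⟩ := hadd 0
    exact ne_zero_of_le hr0 (((le_add_of_nonneg_left zero_le).trans hr).trans (hb.1 ⟨1, rfl⟩))
  refine ⟨hb0, Or.inr ⟨hb0, fun x' hx' => ?_⟩⟩
  obtain ⟨n, hn⟩ := hx' P hmono b hb le_rfl
  obtain ⟨r, hr0, hr⟩ := hadd n
  refine ⟨r, hr0, ?_⟩
  calc x' + r ≤ P n + r := by gcongr
    _ ≤ P (n + 1) := hr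
    _ ≪ P (n + 1) := hP _
    _ ≤ b := hb.1 ⟨n + 1, rfl⟩

theorem CompactsSplit.exists_seq (hsplit : CompactsSplit T) (halg : Algebraic T)
    (hc : WeaklyCancellative T) (hO5 : O5 T) (hdir : NonzeroDirected T) (d : ℕ → T)
    (hcpt : IsCompactElt c) (hc0 : c ≠ 0) :
    ∃ P p : ℕ → T, (∀ n, IsCompactElt (P n)) ∧ (∀ n, P n + p n = c) ∧
      (∀ n, ∃ r, r ≠ 0 ∧ P n + r ≤ P (n + 1)) ∧ ∀ n, d n ≠ 0 → p (n + 1) ≤ d n := by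
  have step (n : ℕ) (u : T × T) (hu : u.1 + u.2 = c ∧ IsCompactElt u.2 ∧ u.2 ≠ 0) :
      ∃ u' : T × T, (u'.1 + u'.2 = c ∧ IsCompactElt u'.2 ∧ u'.2 ≠ 0) ∧
        (∃ r, r ≠ 0 ∧ u.1 + r ≤ u'.1) ∧ (d n ≠ 0 → u'.2 ≤ d n) := by
    obtain ⟨hadd, hp, hp0⟩ := hu
    obtain ⟨t, ht0, ht⟩ : ∃ t, t ≠ 0 ∧ (d n ≠ 0 → t ≤ d n) := by
      by_cases h : d n = 0
      · exact ⟨u.2, hp0, fun h' => absurd h h'⟩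
      · exact ⟨d n, h, fun _ => le_rfl⟩
    obtain ⟨r, p', hr0, hrp, hp', hp'0, hp't⟩ :=
      hsplit.exists_add_eq_of_ne_zero halg hc hO5 hdir hp hp0 ht0
    exact ⟨(u.1 + r, p'), ⟨by rw [add_assoc, hrp, hadd], hp', hp'0⟩, ⟨r, hr0, le_rfl⟩,
      fun h => hp't.trans (ht h)⟩
  obtain ⟨u, -, hu, hrel⟩ := exists_seq_of_forall_exists step
    (a := (0, c)) ⟨zero_add c, hcpt, hc0⟩
  refine ⟨fun n => (u n).1, fun n => (u n).2, fun n => ?_, fun n => (hu n).1,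
    fun n => (hrel n).1, fun n => (hrel n).2⟩
  refine IsCompactElt.of_add_left hc (a := (u n).2) ?_
  rwa [add_comm, (hu n).1]

theorem CompactsSplit.exists_isSoft_le (hsplit : CompactsSplit T) (hbased : CountablyBased T)
    (halg : Algebraic T) (hc : WeaklyCancellative T) (hO5 : O5 T) (hdir : NonzeroDirected T)
    (hcpt : IsCompactElt c) (hc0 : c ≠ 0) :
    ∃ b, IsSoft b ∧ b ≠ 0 ∧ b ≤ c ∧ ∀ t, t ≠ 0 → c ≤ b + t := by
  obtain ⟨d, hd⟩ := hbased.exists_seq_le_of_ne_zero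
  obtain ⟨P, p, hP, hPp, hadd, hpd⟩ := hsplit.exists_seq halg hc hO5 hdir d hcpt hc0
  have hmono := monotone_of_add_le_succ hadd
  obtain ⟨b, hb⟩ := IsCuSemigroup.exists_sup P hmono
  obtain ⟨hb0, hsoft⟩ := isSoft_of_isLUB_of_isCompactElt hP hadd hb
  refine ⟨b, hsoft, hb0, hb.2 (Set.forall_mem_range.2 fun n => ?_), fun t ht => ?_⟩
  · exact hPp n ▸ le_add_of_nonneg_right zero_le
  · obtain ⟨n, hn0, hn⟩ := hd t ht
    calc c = P (n + 1) + p (n + 1) := (hPp _).symm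
      _ ≤ b + t := add_le_add (hb.1 ⟨n + 1, rfl⟩) ((hpd n hn0).trans hn)

theorem CompactsSplit.exists_isSoft_between (hsplit : CompactsSplit T)
    (hbased : CountablyBased T) (halg : Algebraic T) (hc : WeaklyCancellative T) (hO5 : O5 T)
    (hdir : NonzeroDirected T) {x y : T} (hx : IsSoft x) (hyx : y ≪ x) :
    ∃ z ∈ softPart T, y ≤ z ∧ z ≪ x := by
  by_cases hx0 : x = 0
  · subst hx0
    exact ⟨0, zero_mem _, hyx.le, zero_wayBelow 0⟩
  obtain ⟨t, ht0, ht⟩ := hx.exists_add_wayBelow hx0 hyx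
  obtain ⟨c, hcpt, hc0, hct⟩ := halg.exists_isCompactElt_le ht0
  obtain ⟨b, hb, hb0, hbc, -⟩ := hsplit.exists_isSoft_le hbased halg hc hO5 hdir hcpt hc0
  refine ⟨y + b, hb.add_left_of_ne_zero hb0 y, le_add_of_nonneg_right zero_le, ?_⟩
  calc y + b ≤ y + t := by gcongr; exact hbc.trans hct
    _ ≪ x := ht

theorem wayBelow_of_coe {x y : softPart T} (h : (x : T) ≪ y) : x ≪ y := by
  intro u hu s hs hys
  obtain ⟨s', hs'⟩ := IsCuSemigroup.exists_sup (fun n => (u n : T)) fun _ _ hij => hu hij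
  have hsoft : IsSoft s' := isSoft_of_isLUB (fun _ _ hij => hu hij) (fun n => (u n).2) hs'
  have hss' : s ≤ ⟨s', hsoft⟩ := hs.2 (Set.forall_mem_range.2 fun n => hs'.1 ⟨n, rfl⟩)
  exact h _ (fun _ _ hij => hu hij) s' hs' (le_trans hys hss')

theorem CompactsSplit.coe_wayBelow (hsplit : CompactsSplit T) (hbased : CountablyBased T)
    (halg : Algebraic T) (hc : WeaklyCancellative T) (hO5 : O5 T) (hdir : NonzeroDirected T)
    {x y : softPart T} (h : x ≪ y) : (x : T) ≪ y := by
  obtain ⟨d, hd, hdd, hdy⟩ := exists_wayBelow_seq_mem fun _ hz =>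
    hsplit.exists_isSoft_between hbased halg hc hO5 hdir y.2 hz
  obtain ⟨n, hn⟩ := h (fun n => ⟨d n, hd n⟩)
    (fun _ _ hij => monotone_of_wayBelow_succ hdd hij) y
    ⟨Set.forall_mem_range.2 fun n => hdy.1 ⟨n, rfl⟩,
      fun w hw => hdy.2 (Set.forall_mem_range.2 fun n => hw ⟨n, rfl⟩)⟩ le_rfl
  exact WayBelow.le_trans hn (wayBelow_of_isLUB hdd hdy n)

theorem CompactsSplit.isSupDense_hasThinBoundary_softPart (hsplit : CompactsSplit T)
    (hbased : CountablyBased T) (halg : Algebraic T) (hc : WeaklyCancellative T) (hO5 : O5 T)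
    (hdir : NonzeroDirected T) : IsSupDense {x : softPart T | HasThinBoundary x} := by
  intro x' x hx
  by_cases hx0 : (x : T) = 0
  · obtain rfl : x = 0 := Subtype.ext hx0
    exact ⟨0, fun t _ => wayBelow_of_coe (zero_wayBelow _), hx.le,
      wayBelow_of_coe (zero_wayBelow _)⟩
  obtain ⟨c₀, -, hx'c₀, hc₀x⟩ := halg _ _ (hsplit.coe_wayBelow hbased halg hc hO5 hdir hx)
  obtain ⟨t, ht0, ht⟩ := x.2.exists_add_wayBelow hx0 hc₀x
  obtain ⟨c, hcpt, htc, hcx⟩ := halg _ _ ht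
  obtain ⟨b, hb, -, hbc, hcb⟩ := hsplit.exists_isSoft_le hbased halg hc hO5 hdir hcpt
    (ne_zero_of_le ht0 ((le_add_of_nonneg_left zero_le).trans htc))
  have hthin {r : T} (hr : r ≠ 0) : c ≪ b + r := hcpt.trans_le (hcb r hr)
  have hc₀b : c₀ ≪ b := hc _ _ t ((hthin ht0).le_trans htc)
  exact ⟨⟨b, hb⟩, fun r hr => wayBelow_of_coe ((hthin (Subtype.coe_ne_coe.2 hr)).le_trans hbc),
    hx'c₀.trans hc₀b.le, wayBelow_of_coe (hcx.le_trans hbc)⟩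

theorem isSupDense_hasThinBoundary_softPart (hbased : CountablyBased T) (hS : Simple T)
    (halg : Algebraic T) (hc : WeaklyCancellative T) (hO5 : O5 T) (hO6 : O6 T) :
    IsSupDense {x : softPart T | HasThinBoundary x} := by
  have hdir := hS.nonzeroDirected hO6
  by_cases hsplit : CompactsSplit T
  · exact hsplit.isSupDense_hasThinBoundary_softPart hbased halg hc hO5 hdir
  have htop (s : softPart T) (hs : s ≠ 0) (q : softPart T) : q ≤ s := by
    by_contra h
    exact hsplit (hS.compactsSplit halg hO5 hdir s.2 (fun h0 => hs (Subtype.ext h0)) h)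
  intro x' x hx
  refine ⟨x', fun t ht => hx.trans_le ((htop t ht x).trans ?_), le_rfl, hx⟩
  exact le_add_of_nonneg_left (a := (t : T)) zero_le

end Algebraic

end CuntzSemigroup

theorem mainTheorem7 (S : Type u) [AddCommMonoid S] [PartialOrder S] [IsCuSemigroup S]
    (hbased : CountablyBased S) (hsimple : Simple S) (hsoft : Soft S)
    (hcancel : WeaklyCancellative S) (hO5 : O5 S) (hO6 : O6 S) :
    List.TFAE [
      dim S = 0,
      IsSupDense {x : S | HasThinBoundary x},
      ∃ (T : Type u) (_ : AddCommMonoid T) (_ : PartialOrder T) (_ : IsCuSemigroup T),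
        CountablyBased T ∧ Simple T ∧ Algebraic T ∧ WeaklyCancellative T ∧ O5 T ∧ O6 T ∧
          Nonempty (S ≃+o softPart T)] := by
  have hdir := hsimple.nonzeroDirected hO6
  tfae_have 1 → 2 := fun hdim =>
    (dim_eq_zero_iff.1 hdim).isSupDense_hasThinBoundary hbased hsimple hsoft hcancel hO5 hdir
  tfae_have 2 → 1 := fun hdense =>
    dim_eq_zero_iff.2 (dimLE_zero_of_isSupDense_hasThinBoundary hdense hsoft hcancel hO5 hO6)
  tfae_have 2 → 3 := fun hdense => by
    obtain ⟨C⟩ := exists_compactCore hbased hdense hsoft hcancel hO5 hO6 hdir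
    exact ⟨C.Extension, inferInstance, inferInstance, inferInstance,
      CompactCore.Extension.countablyBased, CompactCore.Extension.simple hsimple,
      CompactCore.Extension.algebraic, CompactCore.Extension.weaklyCancellative,
      CompactCore.Extension.o5 hO5, CompactCore.Extension.o6, ⟨CompactCore.Extension.softEquiv C⟩⟩
  tfae_have 3 → 2 := by
    rintro ⟨T, _, _, _, hTbased, hTsimple, hTalg, hTcancel, hTO5, hTO6, ⟨e⟩⟩
    exact (isSupDense_hasThinBoundary_softPart hTbased hTsimple hTalg hTcancel hTO5
      hTO6).of_orderAddMonoidIso e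
  tfae_finish
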